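/- All graphs are undirected and simple. A graph $H$ embeds in a graph $G$ if $H$ is isomorphic to an induced subgraph of $G$; the age of $G$ is the collection of finite graphs that embed in $G$, considered up to isomorphism. A graph $G$ is path-minimal if it contains finite induced paths of unbounded length and $G$ embeds in every induced subgraph $G'$ of $G$ that contains finite induced paths of unbounded length. A word $u\in\{0,1\}^{\mathbb N}$ is uniformly recurrent if for every $n$ there is an $m$ such that every factor of $u$ of length $n$ occurs in every factor of $u$ of length $m$. Given an operation $\star:\{0,1\}^2\to\{0,1\}$, a word $u$ and a sequence $I=(I_n)_{n\in\mathbb N}$ of finite intervals of $\mathbb N$ of unbounded length, let $\widehat Q_{(u,\star),I}$ be the graph on $\bigcup_n \{n\}\times I_n$ in which $(n,x)$ and $(n,y)$ are adjacent iff $|x-y|=1$, and, for $n<m$, $(n,x)$ and $(m,y)$ are adjacent iff $u(x)\star u(y)=1$ (a lexicographical sum over $\omega$ of finite paths labelled by factors of $u$). **Theorem.** There are $2^{\aleph_0}$ path-minimal graphs whose ages are pairwise incomparable under inclusion and are well-quasi-ordered under embeddability. More precisely, there are an operation $\star$ on $\{0,1\}$ and a set $U\subseteq\{0,1\}^{\mathbb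 N}$ of $2^{\aleph_0}$ uniformly recurrent words such that, for every sequence $I$ of finite intervals of $\mathbb N$ of unbounded length, the graphs $\widehat Q_{(u,\star),I}$ ($u\in U$) are path-minimal, their ages are well-quasi-ordered under embeddability, and for distinct $u,v\in U$ neither of the ages of $\widehat Q_{(u,\star),I}$ and $\widehat Q_{(v,\star),I}$ is included in the other. -/

import Mathlib

open scoped SimpleGraph

/-- Every factor of length `n` of the word `u` on `ℕ` occurs inside every factor of length `m`,
for some `m` depending only on `n` and `u`. -/
def UniformlyRecurrent {L : Type*} (u : ℕ → L) : Prop :=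
  ∀ n : ℕ, ∃ m : ℕ, ∀ p q : ℕ, ∃ r : ℕ, q ≤ r ∧ r + n ≤ q + m ∧ ∀ k < n, u (r + k) = u (p + k)

/-- The graph (labels removed) of the lexicographical sum, over the chain `C`, of copies of the
graph `G` labelled by `l`: each `{i} × V` carries a copy of `G`, and for `i < j` the vertices
`(i, x)` and `(j, y)` are adjacent if and only if `l x ⋆ l y = 1`. -/
def lexSumCopies {L V C : Type*} [LinearOrder C] (star : L → L → Bool) (G : SimpleGraph V)
    (l : V → L) : SimpleGraph (C × V) where
  Adj x y := (x.1 = y.1 ∧ G.Adj x.2 y.2) ∨ (x.1 < y.1 ∧ star (l x.2) (l y.2) = true) ∨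
    (y.1 < x.1 ∧ star (l y.2) (l x.2) = true)
  symm := ⟨by
    rintro x y (⟨h, h'⟩ | h | h)
    · exact Or.inl ⟨h.symm, h'.symm⟩
    · exact Or.inr (Or.inr h)
    · exact Or.inr (Or.inl h)⟩
  loopless := ⟨by
    rintro x (⟨_, h⟩ | h | h)
    · exact G.loopless.irrefl _ h
    · exact lt_irrefl _ h.1
    · exact lt_irrefl _ h.1⟩

/-- The lexicographical sum over `ω` of copies of the infinite path on `ℕ` (two integers are
adjacent when they are consecutive) labelled by the word `u`, with the labels removed. -/
def wordGraph {L : Type*} (star : L → L → Bool) (u : ℕ → L) : SimpleGraph (ℕ × ℕ) :=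
  lexSumCopies star (SimpleGraph.hasse ℕ) u

/-- A sequence of finite intervals of `ℕ` whose lengths are unbounded. -/
def IsIntervalFamily (I : ℕ → Set ℕ) : Prop :=
  (∀ n, (I n).OrdConnected) ∧ (∀ n, (I n).Finite) ∧ ∀ k : ℕ, ∃ n, k ≤ (I n).ncard

/-- The restriction of `wordGraph star u` to `⋃ n, {n} × I n`, that is, a lexicographical sum over
`ω` of finite paths labelled by factors of `u`. -/
def wordPathSum {L : Type*} (star : L → L → Bool) (u : ℕ → L) (I : ℕ → Set ℕ) :
    SimpleGraph {x : ℕ × ℕ | x.2 ∈ I x.1} :=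
  (wordGraph star u).induce {x : ℕ × ℕ | x.2 ∈ I x.1}

/-- The graph contains finite induced paths of unbounded length. -/
def HasLongInducedPaths {V : Type*} (G : SimpleGraph V) : Prop :=
  ∀ n : ℕ, ∃ m : ℕ, n ≤ m ∧ SimpleGraph.pathGraph m ⊴ G

/-- Path-minimality: `G` contains finite induced paths of unbounded length, and embeds in each of
its induced subgraphs with this property. -/
def PathMinimal {V : Type*} (G : SimpleGraph V) : Prop :=
  HasLongInducedPaths G ∧ ∀ A : Set V, HasLongInducedPaths (G.induce A) → G ⊴ G.induce A

/-- Finite graphs, each represented up to isomorphism by graphs on some `Fin n`. -/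
abbrev FinGraph : Type := Σ n : ℕ, SimpleGraph (Fin n)

/-- Embeddability (as an induced subgraph) between finite graphs. -/
def FinGraph.Embeds (H K : FinGraph) : Prop := H.2 ⊴ K.2

/-- The age of `G`: the finite graphs that embed in `G` as induced subgraphs. -/
def graphAge {V : Type*} (G : SimpleGraph V) : Set FinGraph := {H | H.2 ⊴ G}

/-! Take `and` for the operation and, for the words, the mechanical words of slope `α` in `(1/2,
1)`: they are uniformly recurrent and have no two consecutive zeros. Because of the latter, an
induced path with at least eight vertices stays in one summand, where it is an interval
(`IsInducedPath.exists_eq_block`).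

Path-minimality: a subgraph with long induced paths contains long intervals in arbitrarily late
summands. By recurrence these contain every factor, so the summands can be re-embedded one by one
(`pathMinimal_wordPathSum`).

Well-quasi-order: factors of a recurrent word are well-quasi-ordered, and two applications of
Higman's theorem lift this to linear forests and then to finite subsets of the sum.

Incomparability: a path plus a vertex labelled 1 in another summand encodes a factor up to reversal,
and the number of ones in a factor of length `n` determines the slope up to `2 / n`. -/

/-- It suffices to bound the recurrence time of each factor separately, as there are finitely many
factors of each length. -/
theorem uniformlyRecurrent_of_forall_factor {L : Type*} [Finite L] {u : ℕ → L}
    (h : ∀ n p : ℕ, ∃ m : ℕ, ∀ q : ℕ, ∃ r : ℕ, q ≤ r ∧ r + n ≤ q + m ∧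
      ∀ k < n, u (r + k) = u (p + k)) : UniformlyRecurrent u := by
  intro n
  have hw : ∀ w : Fin n → L, ∃ m : ℕ, ∀ p : ℕ, (∀ k : Fin n, u (p + k) = w k) → ∀ q : ℕ,
      ∃ r : ℕ, q ≤ r ∧ r + n ≤ q + m ∧ ∀ k : Fin n, u (r + k) = w k := by
    intro w
    by_cases hp : ∃ p : ℕ, ∀ k : Fin n, u (p + k) = w k
    · obtain ⟨p, hp⟩ := hp
      obtain ⟨m, hm⟩ := h n p
      refine ⟨m, fun _ _ q => ?_⟩
      obtain ⟨r, h1, h2, h3⟩ := hm q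
      exact ⟨r, h1, h2, fun k => (h3 k k.2).trans (hp k)⟩
    · exact ⟨0, fun p h' => (hp ⟨p, h'⟩).elim⟩
  choose m hm using hw
  obtain ⟨M, hM⟩ := (Set.finite_range m).bddAbove
  refine ⟨M, fun p q => ?_⟩
  obtain ⟨r, h1, h2, h3⟩ := hm (fun k => u (p + k)) p (fun _ => rfl) q
  have := hM ⟨fun k => u (p + k), rfl⟩
  exact ⟨r, h1, by omega, fun k hk => h3 ⟨k, hk⟩⟩

/-! ### Mechanical words: balance and recurrence -/

/-- The mechanical word of slope `α`: its `n`-th letter says whether there is an integer in the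
interval `(n * α, (n + 1) * α]`. -/
noncomputable def mechanicalWord (α : ℝ) (n : ℕ) : Bool :=
  decide (⌊(n : ℝ) * α⌋ < ⌊((n + 1 : ℕ) : ℝ) * α⌋)

/-- As `0 ≤ α ≤ 1`, the floor grows by 0 or 1 at each step and the letter is that increment, so the
sum telescopes. -/
theorem sum_mechanicalWord {α : ℝ} (h0 : 0 ≤ α) (h1 : α ≤ 1) (p n : ℕ) :
    ∑ k ∈ Finset.range n, (if mechanicalWord α (p + k) = true then (1 : ℤ) else 0) =
      ⌊((p + n : ℕ) : ℝ) * α⌋ - ⌊(p : ℝ) * α⌋ := by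
  induction n with
  | zero => simp
  | succ n ih =>
    rw [Finset.sum_range_succ, ih, ← add_assoc]
    have hle : ⌊((p + n : ℕ) : ℝ) * α⌋ ≤ ⌊((p + n + 1 : ℕ) : ℝ) * α⌋ :=
      Int.floor_le_floor (by push_cast; nlinarith)
    have hlt : ⌊((p + n + 1 : ℕ) : ℝ) * α⌋ ≤ ⌊((p + n : ℕ) : ℝ) * α⌋ + 1 := by
      rw [← Int.floor_add_one]
      exact Int.floor_le_floor (by push_cast; nlinarith)
    have hiff : mechanicalWord α (p + n) = true ↔
        ⌊((p + n : ℕ) : ℝ) * α⌋ < ⌊((p + n + 1 : ℕ) : ℝ) * α⌋ := by simp [mechanicalWord]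
    split_ifs with hc <;> rw [hiff] at hc <;> omega

theorem abs_sum_mechanicalWord_sub_lt {α : ℝ} (h0 : 0 ≤ α) (h1 : α ≤ 1) (p n : ℕ) :
    |((∑ k ∈ Finset.range n, (if mechanicalWord α (p + k) = true then (1 : ℤ) else 0) : ℤ) : ℝ) -
      n * α| < 1 := by
  rw [sum_mechanicalWord h0 h1, abs_lt]
  have a1 := Int.floor_le (((p + n : ℕ) : ℝ) * α)
  have a2 := Int.lt_floor_add_one (((p + n : ℕ) : ℝ) * α)
  have b1 := Int.floor_le ((p : ℝ) * α)
  have b2 := Int.lt_floor_add_one ((p : ℝ) * α)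
  push_cast at *
  constructor <;> linarith

/-- Above slope `1 / 2` there are no two consecutive zeros. -/
theorem mechanicalWord_or_succ {α : ℝ} (h0 : 1 / 2 ≤ α) (h1 : α ≤ 1) (n : ℕ) :
    mechanicalWord α n = true ∨ mechanicalWord α (n + 1) = true := by
  by_contra! h
  have hs := sum_mechanicalWord (by linarith) h1 n 2
  have : ⌊(n : ℝ) * α⌋ + 1 ≤ ⌊((n + 2 : ℕ) : ℝ) * α⌋ := by
    rw [← Int.floor_add_one]
    exact Int.floor_le_floor (by push_cast; linarith)
  rw [Finset.sum_range_succ, Finset.sum_range_one, add_zero, if_neg h.1, if_neg h.2] at hs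
  omega

/-- Multiples of a small number, of either sign, come close to an integer from above. -/
theorem exists_nat_int_add_mul_sub_mem_Ico {η ε : ℝ} (hη : η ≠ 0) (hε : |η| ≤ ε) {N : ℕ}
    (hN : 1 / |η| + 1 ≤ N) (y : ℝ) :
    ∃ (s : ℕ) (z : ℤ), s ≤ N ∧ y + s * η - z ∈ Set.Ico 0 ε := by
  -- Steps of size `|η|` go down from `y` to its floor if `η < 0`, and up to its ceiling if `η > 0`.
  rcases hη.lt_or_gt with h | h
  · have ha : |η| = -η := abs_of_neg h
    rw [ha] at hε hN
    have hf := Int.fract_nonneg y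
    have hf1 := Int.fract_lt_one y
    have hq : 0 ≤ Int.fract y / -η := div_nonneg hf (by linarith)
    have h1 := Nat.floor_le hq
    have h2 := Nat.lt_floor_add_one (Int.fract y / -η)
    rw [le_div_iff₀ (by linarith)] at h1
    rw [div_lt_iff₀ (by linarith)] at h2
    refine ⟨⌊Int.fract y / -η⌋₊, ⌊y⌋, ?_, ?_, ?_⟩
    · have : Int.fract y / -η ≤ 1 / -η := by gcongr; linarith
      have h3 := Nat.floor_le hq
      exact (Nat.cast_le (α := ℝ)).1 (by linarith)
    · have := Int.floor_add_fract y
      linarith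
    · have := Int.floor_add_fract y
      linarith
  · rw [abs_of_pos h] at hε hN
    have hc := Int.le_ceil y
    have hc1 := Int.ceil_lt_add_one y
    have hq : 0 ≤ (⌈y⌉ - y) / η := div_nonneg (by linarith) h.le
    have h1 := Nat.le_ceil ((⌈y⌉ - y) / η)
    have h2 := Nat.ceil_lt_add_one hq
    have h3 : (⌈y⌉ - y) / η ≤ 1 / η := by gcongr; linarith
    refine ⟨⌈(⌈y⌉ - y) / η⌉₊, ⌈y⌉, ?_, ?_, ?_⟩
    · exact (Nat.cast_le (α := ℝ)).1 (by linarith)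
    · rw [div_le_iff₀ h] at h1
      linarith
    · rw [← sub_lt_iff_lt_add, lt_div_iff₀ h] at h2
      linarith

/-- The orbit of a rotation of the circle returns to a right neighbourhood of each of its points
within bounded time. -/
theorem exists_bounded_return_rotation (α : ℝ) (p : ℕ) {ε : ℝ} (hε : 0 < ε) :
    ∃ m : ℕ, ∀ q : ℕ, ∃ r : ℕ, q ≤ r ∧ r ≤ q + m ∧
      ∃ z : ℤ, (r : ℝ) * α - p * α - z ∈ Set.Ico 0 ε := by
  obtain ⟨n, hn⟩ := exists_nat_one_div_lt hε
  -- Dirichlet: `k` turns of the rotation move a point by at most `ε`. If they do not move it at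
  -- all, `k` is an exact period.
  obtain ⟨j, k, hk, -, hjk⟩ := Real.exists_int_int_abs_mul_sub_le α n.succ_pos
  lift k to ℕ using hk.le
  have hk : 0 < k := by exact_mod_cast hk
  set η : ℝ := (k : ℝ) * α - j with hη
  have hηε : |η| ≤ ε := by
    refine (hjk.trans ?_).trans hn.le
    push_cast
    gcongr
    linarith
  rcases eq_or_ne η 0 with h0 | h0
  · refine ⟨p + k, fun q => ⟨p + k * (q / k + 1), ?_, ?_, j * ((q / k + 1 : ℕ) : ℤ), ?_⟩⟩
    · have := Nat.lt_mul_div_succ q hk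
      omega
    · have := Nat.mul_div_le q k
      rw [mul_add]
      omega
    · have : (k : ℝ) * α = j := by linarith
      have h : ((p + k * (q / k + 1) : ℕ) : ℝ) * α - p * α - ((j * ((q / k + 1 : ℕ) : ℤ) : ℤ) : ℝ) =
          (k * α - j) * ((q / k + 1 : ℕ) : ℝ) := by
        rw [Int.cast_mul, Int.cast_natCast, Nat.cast_add, Nat.cast_mul]
        ring
      rw [h, this]
      simpa using hε
  · obtain ⟨N, hN⟩ := exists_nat_ge (1 / |η| + 1)
    refine ⟨N * k, fun q => ?_⟩
    obtain ⟨s, z, hs, hz⟩ := exists_nat_int_add_mul_sub_mem_Ico h0 hηε hN ((q : ℝ) * α - p * α)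
    refine ⟨q + s * k, Nat.le_add_right _ _, by gcongr, z + s * j, ?_⟩
    convert hz using 1
    rw [hη]
    push_cast
    ring

/-- The floor is right-continuous: a shift to the right, modulo 1, by less than the least distance
`ε` from the points `(p + k) * α` up to the next integer leaves the whole factor unchanged. -/
theorem uniformlyRecurrent_mechanicalWord (α : ℝ) : UniformlyRecurrent (mechanicalWord α) := by
  refine uniformlyRecurrent_of_forall_factor fun n p => ?_
  have hε : ∃ ε : ℝ, 0 < ε ∧ ∀ k ∈ Finset.range (n + 1),
      ε ≤ ⌊((p + k : ℕ) : ℝ) * α⌋ + 1 - ((p + k : ℕ) : ℝ) * α := by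
    refine ⟨(Finset.range (n + 1)).inf' Finset.nonempty_range_add_one
      fun k => ⌊((p + k : ℕ) : ℝ) * α⌋ + 1 - ((p + k : ℕ) : ℝ) * α, ?_, fun k hk => ?_⟩
    · rw [Finset.lt_inf'_iff]
      intro k _
      linarith [Int.lt_floor_add_one (((p + k : ℕ) : ℝ) * α)]
    · exact Finset.inf'_le _ hk
  obtain ⟨ε, h0, hε⟩ := hε
  obtain ⟨m, hm⟩ := exists_bounded_return_rotation α p h0
  refine ⟨m + n, fun q => ?_⟩
  obtain ⟨r, h1, h2, z, hz0, hz1⟩ := hm q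
  have key : ∀ k ≤ n, ⌊((r + k : ℕ) : ℝ) * α⌋ = ⌊((p + k : ℕ) : ℝ) * α⌋ + z := by
    intro k hk
    have := hε k (by simpa [Nat.lt_succ_iff] using hk)
    have hfl := Int.floor_le (((p + k : ℕ) : ℝ) * α)
    rw [Int.floor_eq_iff]
    push_cast at *
    constructor <;> linarith
  refine ⟨r, h1, by omega, fun k hk => ?_⟩
  have e1 := key k hk.le
  have e2 := key (k + 1) hk
  rw [← add_assoc, ← add_assoc] at e2
  simp only [mechanicalWord, e1, e2, add_lt_add_iff_right]

/-- A word contained, up to reversal, in mechanical words of two slopes has length bounded in terms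
of the slopes. -/
theorem slope_close_of_common_factor {α β : ℝ} (hα0 : 0 ≤ α) (hα1 : α ≤ 1) (hβ0 : 0 ≤ β)
    (hβ1 : β ≤ 1) {n a b : ℕ} (h : (∀ k < n, mechanicalWord α (a + k) = mechanicalWord β (b + k)) ∨
      ∀ k < n, mechanicalWord α (a + k) = mechanicalWord β (b + (n - 1 - k))) :
    n * |α - β| < 2 := by
  -- Reversal does not change the number of ones.
  have hsum : ∑ k ∈ Finset.range n, (if mechanicalWord α (a + k) = true then (1 : ℤ) else 0) =
      ∑ k ∈ Finset.range n, (if mechanicalWord β (b + k) = true then (1 : ℤ) else 0) := by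
    rcases h with h | h
    · exact Finset.sum_congr rfl fun k hk => by rw [h k (Finset.mem_range.1 hk)]
    · rw [← Finset.sum_range_reflect
        (fun k => if mechanicalWord β (b + k) = true then (1 : ℤ) else 0)]
      exact Finset.sum_congr rfl fun k hk => by rw [h k (Finset.mem_range.1 hk)]
  have h1 := abs_sum_mechanicalWord_sub_lt hα0 hα1 a n
  have h2 := abs_sum_mechanicalWord_sub_lt hβ0 hβ1 b n
  rw [hsum] at h1
  rw [← abs_of_nonneg (Nat.cast_nonneg (α := ℝ) n), ← abs_mul, mul_sub]
  rw [abs_lt] at *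
  constructor <;> linarith

/-! ### Well-quasi-ordering of the ages -/

/-- The set `s` of vertices of `G` embeds in the set `t`, as an induced subgraph whose vertices are
labelled by `l`. -/
def LabelledEmbeds {V L : Type*} (G : SimpleGraph V) (l : V → L) (s t : Set V) : Prop :=
  ∃ φ : V → V, Set.MapsTo φ s t ∧ Set.InjOn φ s ∧
    (∀ x ∈ s, ∀ y ∈ s, (G.Adj (φ x) (φ y) ↔ G.Adj x y)) ∧ ∀ x ∈ s, l (φ x) = l x

instance {V L : Type*} (G : SimpleGraph V) (l : V → L) :
    IsPreorder (Set V) (LabelledEmbeds G l) where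
  refl s := ⟨id, Set.mapsTo_id s, Set.injOn_id s, fun _ _ _ _ => Iff.rfl, fun _ _ => rfl⟩
  trans := by
    rintro s t r ⟨φ, h1, h2, h3, h4⟩ ⟨ψ, k1, k2, k3, k4⟩
    exact ⟨ψ ∘ φ, k1.comp h1, k2.comp h2 h1,
      fun x hx y hy => (k3 _ (h1 hx) _ (h1 hy)).trans (h3 x hx y hy),
      fun x hx => (k4 _ (h1 hx)).trans (h4 x hx)⟩

/-- Only injectivity on indices is kept from Higman's embedding of lists: the order of the parts
plays no role in adjacency. -/
theorem List.SublistForall₂.exists_injOn_index {α β : Type*} {R : α → β → Prop} {l₁ : List α}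
    {l₂ : List β} (h : List.SublistForall₂ R l₁ l₂) :
    ∃ f : ℕ → ℕ, Set.InjOn f {i | i < l₁.length} ∧
      ∀ i (hi : i < l₁.length), ∃ hf : f i < l₂.length, R l₁[i] l₂[f i] := by
  induction h with
  | nil => exact ⟨id, Set.injOn_id _, fun i hi => (Nat.not_lt_zero i hi).elim⟩
  | cons hab _ ih =>
    obtain ⟨f, hf, hR⟩ := ih
    refine ⟨fun i => i.casesOn 0 fun j => f j + 1, ?_, ?_⟩
    · rintro (_ | i) hi (_ | j) hj hij
      · rfl
      · simp at hij
      · simp at hij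
      · simp only [Set.mem_ofPred_eq, List.length_cons, Nat.add_lt_add_iff_right] at hi hj
        simp only [Nat.add_right_cancel_iff] at hij
        rw [hf hi hj hij]
    · rintro (_ | i) hi
      · exact ⟨by simp, hab⟩
      · obtain ⟨h1, h2⟩ := hR i (by simpa using hi)
        exact ⟨by simpa using h1, by simpa using h2⟩
  | cons_right _ ih =>
    obtain ⟨f, hf, hR⟩ := ih
    refine ⟨fun i => f i + 1, fun i hi j hj hij => hf hi hj (Nat.add_right_cancel hij), ?_⟩
    intro i hi
    obtain ⟨h1, h2⟩ := hR i hi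
    exact ⟨by simpa using h1, by simpa using h2⟩

/-- Higman's theorem for sums of labelled graphs: if every set in `C` splits into finitely many
parts belonging to the well-quasi-ordered collection `S`, and adjacency between distinct parts is
decided by the labels alone, then `C` is well-quasi-ordered. -/
theorem partiallyWellOrderedOn_labelledEmbeds_of_parts {V L : Type*} (G : SimpleGraph V)
    (l : V → L) (adj : L → L → Prop) {S C : Set (Set V)}
    (hS : S.PartiallyWellOrderedOn (LabelledEmbeds G l))
    (hC : ∀ F ∈ C, ∃ (part : V → ℕ) (N : ℕ), (∀ x ∈ F, part x < N) ∧
      (∀ i, {x ∈ F | part x = i} ∈ S) ∧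
      ∀ x ∈ F, ∀ y ∈ F, part x ≠ part y → (G.Adj x y ↔ adj (l x) (l y))) :
    C.PartiallyWellOrderedOn (LabelledEmbeds G l) := by
  rw [Set.partiallyWellOrderedOn_iff_exists_lt]
  intro F hF
  choose part N hN hpart hadj using fun n => hC (F n) (hF n)
  obtain ⟨m, n, hmn, h⟩ :=
    (Set.PartiallyWellOrderedOn.partiallyWellOrderedOn_sublistForall₂ _ hS).exists_lt
    (f := fun n => (List.range (N n)).map fun i => {x ∈ F n | part n x = i}) (by
      intro n s hs
      obtain ⟨i, -, rfl⟩ := List.mem_map.1 hs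
      exact hpart n i)
  obtain ⟨f, hf, hR⟩ := h.exists_injOn_index
  have hR' : ∀ i, ∃ φ : V → V, i < N m →
      Set.MapsTo φ {x ∈ F m | part m x = i} {x ∈ F n | part n x = f i} ∧
      Set.InjOn φ {x ∈ F m | part m x = i} ∧
      (∀ x ∈ {x ∈ F m | part m x = i}, ∀ y ∈ {x ∈ F m | part m x = i},
        (G.Adj (φ x) (φ y) ↔ G.Adj x y)) ∧ ∀ x ∈ {x ∈ F m | part m x = i}, l (φ x) = l x := by
    intro i
    by_cases hi : i < N m
    · obtain ⟨h1, h2⟩ := hR i (by simpa using hi)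
      rw [List.getElem_map, List.getElem_map, List.getElem_range, List.getElem_range] at h2
      obtain ⟨φ, hφ⟩ := h2
      exact ⟨φ, fun _ => hφ⟩
    · exact ⟨id, fun h => (hi h).elim⟩
  have hf' : ∀ i < N m, ∀ j < N m, f i = f j → i = j := fun i hi j hj hij =>
    hf (by simpa using hi) (by simpa using hj) hij
  choose φ hφ using hR'
  have h1 := fun i hi => (hφ i hi).1
  have h2 := fun i hi => (hφ i hi).2.1
  have h3 := fun i hi => (hφ i hi).2.2.1
  have h4 := fun i hi => (hφ i hi).2.2.2
  have hφF : ∀ x ∈ F m, φ (part m x) x ∈ F n ∧ part n (φ (part m x) x) = f (part m x) :=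
    fun x hx => h1 _ (hN m x hx) ⟨hx, rfl⟩
  refine ⟨m, n, hmn, fun x => φ (part m x) x, fun x hx => (hφF x hx).1, ?_, ?_,
    fun x hx => h4 _ (hN m x hx) x ⟨hx, rfl⟩⟩
  · intro x hx y hy hxy
    have hp : part m x = part m y := hf' _ (hN m x hx) _ (hN m y hy) (by
      rw [← (hφF x hx).2, ← (hφF y hy).2]
      exact congrArg _ hxy)
    refine h2 _ (hN m y hy) ⟨hx, hp⟩ ⟨hy, rfl⟩ ?_
    simpa only [hp] using hxy
  · intro x hx y hy
    by_cases hp : part m x = part m y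
    · simpa only [hp] using h3 _ (hN m y hy) x ⟨hx, hp⟩ y ⟨hy, rfl⟩
    · have hp' : part n (φ (part m x) x) ≠ part n (φ (part m y) y) := by
        rw [(hφF x hx).2, (hφF y hy).2]
        exact fun h => hp (hf' _ (hN m x hx) _ (hN m y hy) h)
      rw [hadj m x hx y hy hp, hadj n _ (hφF x hx).1 _ (hφF y hy).1 hp',
        h4 _ (hN m x hx) x ⟨hx, rfl⟩, h4 _ (hN m y hy) y ⟨hy, rfl⟩]

theorem Set.OrdConnected.exists_eq_Ico_add_ncard {s : Set ℕ} (hs : s.OrdConnected)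
    (hfin : s.Finite) : ∃ a, s = Set.Ico a (a + s.ncard) := by
  rcases s.eq_empty_or_nonempty with rfl | hne
  · exact ⟨0, by simp⟩
  obtain ⟨a, ha, ha'⟩ := hfin.exists_minimal hne
  obtain ⟨b, hb, hb'⟩ := hfin.exists_maximal hne
  have h : s = Set.Ico a (b + 1) := by
    ext x
    refine ⟨fun hx => ⟨?_, ?_⟩, fun hx => hs.out ha hb ⟨hx.1, Nat.lt_succ_iff.1 hx.2⟩⟩
    · exact (le_total a x).elim id fun h => ha' hx h
    · exact Nat.lt_succ_iff.2 ((le_total x b).elim id fun h => hb' hx h)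
  have hab : a ≤ b := (le_total a b).elim id fun h => ha' hb h
  refine ⟨a, ?_⟩
  rw [h, ← Finset.coe_Ico, Set.ncard_coe_finset, Nat.card_Ico, Nat.add_sub_cancel' (by omega),
    Finset.coe_Ico]

/-- Since `and` is symmetric, the order of the summands disappears from adjacency. -/
theorem wordGraph_and_adj {u : ℕ → Bool} {x y : ℕ × ℕ} :
    (wordGraph and u).Adj x y ↔ (x.1 = y.1 ∧ (x.2 + 1 = y.2 ∨ y.2 + 1 = x.2)) ∨
      (x.1 ≠ y.1 ∧ u x.2 = true ∧ u y.2 = true) := by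
  simp only [wordGraph, lexSumCopies, SimpleGraph.hasse_adj, Nat.covBy_iff_add_one_eq,
    Bool.and_eq_true]
  rcases lt_trichotomy x.1 y.1 with h | h | h
  · simp [h, h.ne, h.not_gt]
  · simp [h]
  · simp [h, h.ne', h.not_gt, and_comm]

theorem labelledEmbeds_block {u : ℕ → Bool} {i j a b n b' n' : ℕ} (hb : b' ≤ b)
    (hn : b + n ≤ b' + n') (h : ∀ k < n, u (b + k) = u (a + k)) :
    LabelledEmbeds (wordGraph and u) (fun x => u x.2) {x | x.1 = i ∧ x.2 ∈ Set.Ico a (a + n)}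
      {x | x.1 = j ∧ x.2 ∈ Set.Ico b' (b' + n')} := by
  refine ⟨fun x => (j, b + (x.2 - a)), ?_, ?_, ?_, ?_⟩
  · rintro ⟨_, x⟩ ⟨-, h1, h2⟩
    simp only [Set.mem_ofPred_eq, Set.mem_Ico, true_and] at *
    omega
  · rintro ⟨_, x⟩ ⟨rfl, h1, h2⟩ ⟨_, y⟩ ⟨hy, h3, h4⟩ hxy
    simp only [Prod.mk.injEq, true_and] at *
    omega
  · rintro ⟨_, x⟩ ⟨rfl, h1, h2⟩ ⟨_, y⟩ ⟨rfl, h3, h4⟩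
    simp only [wordGraph_and_adj, ne_eq, not_true_eq_false, false_and, or_false, true_and] at *
    omega
  · rintro ⟨_, x⟩ ⟨rfl, h1, h2⟩
    simp only at *
    rw [h (x - a) (by omega), Nat.add_sub_cancel' h1]

/-- The labelled factors of a uniformly recurrent word are well-quasi-ordered. -/
theorem partiallyWellOrderedOn_blocks {u : ℕ → Bool} (hu : UniformlyRecurrent u) :
    {F : Set (ℕ × ℕ) | ∃ i a n, F = {x | x.1 = i ∧ x.2 ∈ Set.Ico a (a + n)}}.PartiallyWellOrderedOn
      (LabelledEmbeds (wordGraph and u) fun x => u x.2) := by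
  rw [Set.partiallyWellOrderedOn_iff_exists_lt]
  intro F hF
  choose i a n hF using hF
  obtain ⟨M, hM⟩ := hu (n 0)
  -- A later factor of length at least `M` contains the initial one. Otherwise all later lengths are
  -- below `M` and the pigeonhole principle gives two equal labelled factors.
  by_cases hlong : ∃ k, 0 < k ∧ M ≤ n k
  · obtain ⟨k, hk, hMk⟩ := hlong
    obtain ⟨r, h1, h2, h3⟩ := hM (a 0) (a k)
    refine ⟨0, k, hk, ?_⟩
    rw [hF, hF]
    exact labelledEmbeds_block h1 (by omega) h3
  · push Not at hlong
    let g : ℕ → Fin M × (Fin M → Bool) := fun k =>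
      (⟨n (k + 1), hlong _ k.succ_pos⟩, fun j => u (a (k + 1) + j))
    obtain ⟨k, k', hne, hg⟩ := Finite.exists_ne_map_eq_of_infinite g
    wlog hlt : k < k' generalizing k k'
    · exact this k' k hne.symm hg.symm (by omega)
    simp only [g, Prod.mk.injEq, Fin.mk.injEq] at hg
    refine ⟨k + 1, k' + 1, by omega, ?_⟩
    rw [hF, hF]
    refine labelledEmbeds_block le_rfl (by omega) fun j hj => ?_
    exact (congrFun hg.2 ⟨j, hj.trans (hlong _ k.succ_pos)⟩).symm

theorem partiallyWellOrderedOn_linearForests {u : ℕ → Bool} (hu : UniformlyRecurrent u) :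
    {F : Set (ℕ × ℕ) | F.Finite ∧ ∃ i, ∀ x ∈ F, x.1 = i}.PartiallyWellOrderedOn
      (LabelledEmbeds (wordGraph and u) fun x => u x.2) := by
  classical
  refine partiallyWellOrderedOn_labelledEmbeds_of_parts _ _ (fun _ _ => False)
    (partiallyWellOrderedOn_blocks hu) ?_
  rintro F ⟨hfin, i, hi⟩
  -- The number of points missing below `y`: constant along a run of consecutive points of `F`,
  -- larger after each hole, so its level sets in `F` are the maximal runs. There is no edge between
  -- distinct runs.
  let gaps : ℕ → ℕ := Nat.count fun y => (i, y) ∉ F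
  have hstep : ∀ x, (i, x) ∈ F → gaps (x + 1) = gaps x := fun x hx => by
    simp [gaps, Nat.count_succ, hx]
  have hmono : Monotone gaps := Nat.count_monotone _
  obtain ⟨N, hN⟩ := (hfin.image fun x => gaps x.2).bddAbove
  refine ⟨fun x => gaps x.2, N + 1, fun x hx => Nat.lt_succ_iff.2 (hN ⟨x, hx, rfl⟩), ?_, ?_⟩
  · intro j
    have hcon : {y | (i, y) ∈ F ∧ gaps y = j}.OrdConnected := by
      refine ⟨fun x hx y hy z hz => ?_⟩
      have hz' : gaps z = j :=
        le_antisymm ((hmono hz.2).trans_eq hy.2) (hx.2.symm.trans_le (hmono hz.1))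
      refine ⟨?_, hz'⟩
      by_contra hzF
      have h1 : gaps (z + 1) = gaps z + 1 := by simp [gaps, Nat.count_succ, hzF]
      have hne : z ≠ y := fun h => hzF (h ▸ hy.1)
      have h2 : gaps (z + 1) ≤ gaps y := hmono (lt_of_le_of_ne hz.2 hne)
      rw [hy.2, h1, hz'] at h2
      omega
    obtain ⟨a, ha⟩ := hcon.exists_eq_Ico_add_ncard
      ((hfin.image Prod.snd).subset fun y hy => ⟨(i, y), hy.1, rfl⟩)
    refine ⟨i, a, {y | (i, y) ∈ F ∧ gaps y = j}.ncard, ?_⟩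
    rw [← ha]
    ext ⟨x, y⟩
    constructor
    · rintro ⟨hx, hj⟩
      obtain rfl : x = i := hi _ hx
      exact ⟨rfl, hx, hj⟩
    · rintro ⟨rfl, hx, hj⟩
      exact ⟨hx, hj⟩
  · rintro ⟨x1, x⟩ hx ⟨y1, y⟩ hy hne
    obtain rfl : x1 = i := hi _ hx
    obtain rfl : y1 = x1 := hi _ hy
    simp only [wordGraph_and_adj, true_and, ne_eq, not_true_eq_false, false_and, or_false,
      iff_false]
    rintro (rfl | rfl)
    · exact hne (hstep _ hx).symm
    · exact hne (hstep _ hy)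

theorem partiallyWellOrderedOn_finite_subsets {u : ℕ → Bool} (hu : UniformlyRecurrent u) :
    {F : Set (ℕ × ℕ) | F.Finite}.PartiallyWellOrderedOn
      (LabelledEmbeds (wordGraph and u) fun x => u x.2) := by
  refine partiallyWellOrderedOn_labelledEmbeds_of_parts _ _ (fun a b => a = true ∧ b = true)
    (partiallyWellOrderedOn_linearForests hu) ?_
  intro F hF
  obtain ⟨N, hN⟩ := (hF.image Prod.fst).bddAbove
  refine ⟨Prod.fst, N + 1, fun x hx => Nat.lt_succ_iff.2 (hN ⟨x, hx, rfl⟩),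
    fun i => ⟨hF.subset fun x hx => hx.1, i, fun x hx => hx.2⟩, fun x _ y _ hne => ?_⟩
  simp [wordGraph_and_adj, hne]

theorem partiallyWellOrderedOn_graphAge {u : ℕ → Bool} (hu : UniformlyRecurrent u)
    (I : ℕ → Set ℕ) :
    (graphAge (wordPathSum and u I)).PartiallyWellOrderedOn FinGraph.Embeds := by
  rw [Set.partiallyWellOrderedOn_iff_exists_lt]
  intro H hH
  have e : ∀ n, (H n).2 ↪g wordPathSum and u I := fun n => Classical.choice (hH n)
  obtain ⟨m, n, hmn, φ, h1, h2, h3, -⟩ := (partiallyWellOrderedOn_finite_subsets hu).exists_lt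
    (f := fun n => Set.range fun v => (e n v).1) fun n => Set.finite_range _
  choose g hg using fun v => h1 ⟨v, rfl⟩
  replace hg : ∀ v, (e n (g v)).1 = φ (e m v).1 := hg
  have hval : ∀ n v w, (wordGraph and u).Adj (e n v).1 (e n w).1 ↔ (H n).2.Adj v w :=
    fun n v w => (e n).map_adj_iff
  refine ⟨m, n, hmn, ⟨⟨⟨g, fun v w hvw => ?_⟩, fun {v w} => ?_⟩⟩⟩
  · have h : φ (e m v).1 = φ (e m w).1 := by rw [← hg, ← hg, hvw]
    exact (e m).injective (Subtype.ext (h2 ⟨v, rfl⟩ ⟨w, rfl⟩ h))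
  · change (H n).2.Adj (g v) (g w) ↔ _
    rw [← hval, ← hval, ← h3 _ ⟨v, rfl⟩ _ ⟨w, rfl⟩, ← hg, ← hg]

/-! ### Long induced paths lie in one summand -/

/-- The first `n` terms of the sequence `g` form an induced path of `G`. -/
structure IsInducedPath {V : Type*} (G : SimpleGraph V) (g : ℕ → V) (n : ℕ) : Prop where
  adj_iff : ∀ i < n, ∀ j < n, (G.Adj (g i) (g j) ↔ i + 1 = j ∨ j + 1 = i)
  inj : ∀ i < n, ∀ j < n, g i = g j → i = j

theorem SimpleGraph.Embedding.exists_isInducedPath {V : Type*} [Nonempty V] {G : SimpleGraph V}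
    {n : ℕ} (e : SimpleGraph.pathGraph n ↪g G) :
    ∃ g, IsInducedPath G g n ∧ ∀ i : Fin n, g i = e i := by
  refine ⟨fun i => if h : i < n then e ⟨i, h⟩ else Classical.arbitrary V, ⟨?_, ?_⟩, ?_⟩
  · intro i hi j hj
    simp [hi, hj, SimpleGraph.pathGraph_adj]
  · intro i hi j hj hij
    simpa [hi, hj] using hij
  · intro i
    simp

/-- In the graph of a word without two consecutive zeros, every induced path with at least eight
vertices lies in a single summand. -/
theorem IsInducedPath.fst_eq {u : ℕ → Bool} (hu : ∀ n, u n = true ∨ u (n + 1) = true)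
    {g : ℕ → ℕ × ℕ} {n : ℕ} (hn : 8 ≤ n) (h : IsInducedPath (wordGraph and u) g n) :
    ∀ i < n, (g i).1 = (g 0).1 := by
  have hzero : ∀ i, i + 1 < n → u (g i).2 = true ∨ u (g (i + 1)).2 = true := by
    intro i hi
    by_contra! hc
    rcases wordGraph_and_adj.1 ((h.adj_iff i (by omega) (i + 1) hi).2 (.inl rfl)) with
      ⟨-, h1 | h1⟩ | h1
    · have := hu (g i).2
      rw [h1] at this
      tauto
    · have := hu (g (i + 1)).2
      rw [h1] at this
      tauto
    · exact hc.1 h1.2.1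
  have hone : ∀ i < n, ∀ j < n, u (g i).2 = true → u (g j).2 = true → (g i).1 ≠ (g j).1 →
      i + 1 = j ∨ j + 1 = i := fun i hi j hj h1 h2 h3 =>
    (h.adj_iff i hi j hj).1 (wordGraph_and_adj.2 (.inr ⟨h3, h1, h2⟩))
  have hall : ∀ i < n, ∀ j < n, u (g i).2 = true → u (g j).2 = true → (g i).1 = (g j).1 := by
    intro i hi j hj h1 h2
    by_contra h3
    -- A third vertex labelled 1 is in a different summand from `g i` or from `g j`, hence is next
    -- to one of them on the path.
    have hclose : ∀ k < n, u (g k).2 = true → i ≤ k + 2 ∧ k ≤ i + 2 := by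
      intro k hk hk1
      have hij := hone i hi j hj h1 h2 h3
      by_cases hik : (g i).1 = (g k).1
      · have := hone k hk j hj hk1 h2 (hik ▸ h3)
        omega
      · have := hone i hi k hk h1 hk1 hik
        omega
    -- A one occurs among vertices 6 and 7 and among vertices 0 and 1; one of these is too far from
    -- `i`. This is where eight vertices are needed.
    rcases le_or_gt i 3 with hi3 | hi3
    · rcases hzero 6 (by omega) with h6 | h6
      · have := hclose _ (by omega) h6
        omega
      · have := hclose _ (by omega) h6
        omega
    · rcases hzero 0 (by omega) with h6 | h6
      · have := hclose _ (by omega) h6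
        omega
      · have := hclose _ (by omega) h6
        omega
  intro i
  induction i with
  | zero => exact fun _ => rfl
  | succ i ih =>
    intro hi
    rw [← ih (by omega)]
    rcases wordGraph_and_adj.1 ((h.adj_iff i (by omega) (i + 1) hi).2 (.inl rfl)) with h1 | h1
    · exact h1.1.symm
    · exact hall _ hi _ (by omega) h1.2.2 h1.2.1

/-- An injective walk on `ℕ` with unit steps is monotone. -/
theorem exists_forall_lt_eq_add_or_eq_add_sub {f : ℕ → ℕ} {n : ℕ} (hn : 2 ≤ n)
    (hstep : ∀ i, i + 1 < n → f i + 1 = f (i + 1) ∨ f (i + 1) + 1 = f i)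
    (hinj : ∀ i < n, ∀ j < n, f i = f j → i = j) :
    ∃ a, (∀ i < n, f i = a + i) ∨ ∀ i < n, f i = a + (n - 1 - i) := by
  rcases hstep 0 hn with h0 | h0
  -- Injectivity forbids turning back, so the first step fixes the direction.
  · have key : ∀ i, i + 1 < n → f i = f 0 + i ∧ f (i + 1) = f 0 + (i + 1) := by
      intro i
      induction i with
      | zero => exact fun _ => ⟨rfl, h0.symm⟩
      | succ i ih =>
        intro hi
        obtain ⟨h1, h2⟩ := ih (by omega)
        have h3 := hstep (i + 1) hi
        have h4 : f (i + 1 + 1) ≠ f i := fun h => by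
          have := hinj _ hi _ (by omega) h
          omega
        omega
    refine ⟨f 0, .inl fun i hi => ?_⟩
    rcases i with _ | i
    · rfl
    · exact (key i hi).2
  · have key : ∀ i, i + 1 < n → f i + i = f 0 ∧ f (i + 1) + (i + 1) = f 0 := by
      intro i
      induction i with
      | zero => exact fun _ => ⟨rfl, h0⟩
      | succ i ih =>
        intro hi
        obtain ⟨h1, h2⟩ := ih (by omega)
        have h3 := hstep (i + 1) hi
        have h4 : f (i + 1 + 1) ≠ f i := fun h => by
          have := hinj _ hi _ (by omega) h
          omega
        omega
    obtain ⟨m, rfl⟩ : ∃ m, n = m + 2 := ⟨n - 2, by omega⟩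
    have hm := (key m (by omega)).2
    refine ⟨f (m + 1), .inr fun i hi => ?_⟩
    rcases i with _ | i
    · omega
    · have := (key i hi).2
      omega

theorem IsInducedPath.exists_eq_block {u : ℕ → Bool} (hu : ∀ n, u n = true ∨ u (n + 1) = true)
    {g : ℕ → ℕ × ℕ} {n : ℕ} (hn : 8 ≤ n) (h : IsInducedPath (wordGraph and u) g n) :
    ∃ c a, (∀ i < n, g i = (c, a + i)) ∨ ∀ i < n, g i = (c, a + (n - 1 - i)) := by
  have hfst := h.fst_eq hu hn
  obtain ⟨a, ha⟩ := exists_forall_lt_eq_add_or_eq_add_sub (f := fun i => (g i).2) (n := n)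
    (by omega) (fun i hi => by
      rcases wordGraph_and_adj.1 ((h.adj_iff i (by omega) (i + 1) hi).2 (.inl rfl)) with h1 | h1
      · exact h1.2
      · exact (h1.1 ((hfst i (by omega)).trans (hfst _ hi).symm)).elim)
    (fun i hi j hj hij => h.inj i hi j hj
      (Prod.ext ((hfst i hi).trans (hfst j hj).symm) hij))
  exact ⟨(g 0).1, a, ha.imp (fun h i hi => Prod.ext (hfst i hi) (h i hi))
    fun h i hi => Prod.ext (hfst i hi) (h i hi)⟩

theorem isInducedPath_block (u : ℕ → Bool) (c a n : ℕ) :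
    IsInducedPath (wordGraph and u) (fun i => (c, a + i)) n := by
  refine ⟨fun i _ j _ => ?_, fun i _ j _ hij => by simpa using hij⟩
  simp only [wordGraph_and_adj, ne_eq, not_true_eq_false, false_and, or_false, true_and]
  omega

/-! ### Path-minimality -/

theorem IsIntervalFamily.exists_gt_le_ncard {I : ℕ → Set ℕ} (hI : IsIntervalFamily I)
    (n₀ k : ℕ) : ∃ n, n₀ < n ∧ k ≤ (I n).ncard := by
  obtain ⟨n, hn⟩ := hI.2.2 (max k ((∑ j ∈ Finset.range (n₀ + 1), (I j).ncard) + 1))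
  refine ⟨n, ?_, (le_max_left _ _).trans hn⟩
  by_contra! h
  have h1 : (I n).ncard ≤ ∑ j ∈ Finset.range (n₀ + 1), (I j).ncard :=
    Finset.single_le_sum (f := fun j => (I j).ncard) (fun _ _ => Nat.zero_le _)
      (Finset.mem_range.2 (Nat.lt_succ_iff.2 h))
  have h2 := (le_max_right _ _).trans hn
  omega

theorem IsIntervalFamily.exists_gt_forall_mem {I : ℕ → Set ℕ} (hI : IsIntervalFamily I)
    (n₀ k : ℕ) : ∃ n, n₀ < n ∧ ∃ a, ∀ i < k, a + i ∈ I n := by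
  obtain ⟨n, hn, hk⟩ := hI.exists_gt_le_ncard n₀ k
  obtain ⟨a, ha⟩ := (hI.1 n).exists_eq_Ico_add_ncard (hI.2.1 n)
  refine ⟨n, hn, a, fun i hi => ?_⟩
  rw [ha]
  exact ⟨by omega, by omega⟩

theorem hasLongInducedPaths_wordPathSum (u : ℕ → Bool) {I : ℕ → Set ℕ}
    (hI : IsIntervalFamily I) : HasLongInducedPaths (wordPathSum and u I) := by
  intro n
  obtain ⟨c, -, a, ha⟩ := hI.exists_gt_forall_mem 0 (n + 1)
  refine ⟨n + 1, n.le_succ, ?_⟩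
  have h := isInducedPath_block u c a (n + 1)
  refine ⟨⟨⟨fun i : Fin (n + 1) => ⟨(c, a + i), ha i i.2⟩, fun i j hij => ?_⟩, fun {i j} => ?_⟩⟩
  · exact Fin.ext (h.inj i i.2 j j.2 (Subtype.ext_iff.1 hij))
  · exact (h.adj_iff i i.2 j j.2).trans SimpleGraph.pathGraph_adj.symm

theorem exists_gt_block_of_hasLongInducedPaths {u : ℕ → Bool}
    (hu : ∀ n, u n = true ∨ u (n + 1) = true) {I : ℕ → Set ℕ} (hI : IsIntervalFamily I)
    {A : Set {x : ℕ × ℕ | x.2 ∈ I x.1}} (hA : HasLongInducedPaths ((wordPathSum and u I).induce A))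
    (n₀ k : ℕ) : ∃ c, n₀ < c ∧ ∃ a, ∀ i < k, (c, a + i) ∈ Subtype.val '' A := by
  -- 8 makes the path a block, `k` is the required length, and the last term exceeds the size of
  -- every `I j` with `j ≤ n₀`, which forces a later summand.
  obtain ⟨m, hm, ⟨e⟩⟩ := hA (8 + k + ((∑ j ∈ Finset.range (n₀ + 1), (I j).ncard) + 1))
  let e' : SimpleGraph.pathGraph m ↪g wordGraph and u :=
    ((SimpleGraph.Embedding.induce _).comp (SimpleGraph.Embedding.induce A)).comp e
  obtain ⟨g, hg, hge⟩ := e'.exists_isInducedPath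
  have hgA : ∀ i < m, g i ∈ Subtype.val '' A := fun i hi =>
    ⟨(e ⟨i, hi⟩).1, (e ⟨i, hi⟩).2, (hge ⟨i, hi⟩).symm⟩
  obtain ⟨c, a, h⟩ := hg.exists_eq_block hu (by omega)
  have hblock : ∀ i < m, (c, a + i) ∈ Subtype.val '' A := by
    rcases h with h | h
    · exact fun i hi => h i hi ▸ hgA i hi
    · intro i hi
      have := hgA (m - 1 - i) (by omega)
      rwa [h _ (by omega), Nat.sub_sub_self (by omega)] at this
  refine ⟨c, ?_, a, fun i hi => hblock i (by omega)⟩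
  by_contra! hc
  have hsub : Set.Ico a (a + m) ⊆ I c := by
    rintro x ⟨h1, h2⟩
    obtain ⟨y, -, hy⟩ := hblock (x - a) (by omega)
    have := y.2
    rw [hy] at this
    rwa [Nat.add_sub_cancel' h1] at this
  have hcard := Set.ncard_le_ncard hsub (hI.2.1 c)
  rw [← Finset.coe_Ico, Set.ncard_coe_finset, Nat.card_Ico] at hcard
  have h1 : (I c).ncard ≤ ∑ j ∈ Finset.range (n₀ + 1), (I j).ncard :=
    Finset.single_le_sum (f := fun j => (I j).ncard) (fun _ _ => Nat.zero_le _)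
      (Finset.mem_range.2 (Nat.lt_succ_iff.2 hc))
  omega

theorem pathMinimal_wordPathSum {u : ℕ → Bool} (hrec : UniformlyRecurrent u)
    (hu : ∀ n, u n = true ∨ u (n + 1) = true) {I : ℕ → Set ℕ} (hI : IsIntervalFamily I) :
    PathMinimal (wordPathSum and u I) := by
  refine ⟨hasLongInducedPaths_wordPathSum u hI, fun A hA => ?_⟩
  choose a ha using fun n => (hI.1 n).exists_eq_Ico_add_ncard (hI.2.1 n)
  have hcopy : ∀ j n₀, ∃ c, n₀ < c ∧
      ∃ b, ∀ k < (I j).ncard, (c, b + k) ∈ Subtype.val '' A ∧ u (b + k) = u (a j + k) := by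
    intro j n₀
    obtain ⟨m, hm⟩ := hrec (I j).ncard
    obtain ⟨c, hc, b, hb⟩ := exists_gt_block_of_hasLongInducedPaths hu hI hA n₀ m
    obtain ⟨r, h1, h2, h3⟩ := hm (a j) b
    refine ⟨c, hc, r, fun k hk => ⟨?_, h3 k hk⟩⟩
    have := hb (r + k - b) (by omega)
    rwa [Nat.add_sub_cancel' (by omega)] at this
  -- Copies exist in arbitrarily late summands, so distinct summands can be sent to distinct ones.
  obtain ⟨σ, hσ, hσP⟩ := Filter.extraction_forall_of_frequently
    (fun j => Filter.frequently_atTop'.2 (hcopy j))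
  choose b hb using hσP
  have hmem : ∀ x : {x : ℕ × ℕ | x.2 ∈ I x.1}, a x.1.1 ≤ x.1.2 ∧
      x.1.2 - a x.1.1 < (I x.1.1).ncard := by
    rintro ⟨⟨j, x⟩, hx : x ∈ I j⟩
    rw [ha j] at hx
    have := hx.1
    have := hx.2
    constructor <;> simp only <;> omega
  have hex : ∀ x : {x : ℕ × ℕ | x.2 ∈ I x.1}, ∃ y : A,
      y.1.1 = (σ x.1.1, b x.1.1 + (x.1.2 - a x.1.1)) ∧ u y.1.1.2 = u x.1.2 := by
    intro x
    obtain ⟨⟨y, hyA, hy⟩, hu'⟩ := hb x.1.1 (x.1.2 - a x.1.1) (hmem x).2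
    refine ⟨⟨y, hyA⟩, hy, ?_⟩
    rw [hy, hu', Nat.add_sub_cancel' (hmem x).1]
  choose φ hφ hφu using hex
  refine ⟨⟨⟨φ, fun x y hxy => ?_⟩, fun {x y} => ?_⟩⟩
  · have h := hφ x
    rw [hxy, hφ y, Prod.mk.injEq] at h
    have h1 := hσ.injective h.1
    have hx := hmem x
    have hy := hmem y
    rw [h1] at hy h
    refine Subtype.ext (Prod.ext h1.symm ?_)
    omega
  · change (wordGraph and u).Adj (φ x).1.1 (φ y).1.1 ↔ (wordGraph and u).Adj x.1 y.1
    rw [wordGraph_and_adj, wordGraph_and_adj, hφu, hφu, hφ, hφ]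
    simp only [ne_eq, hσ.injective.eq_iff]
    by_cases h1 : x.1.1 = y.1.1
    · have hx := hmem x
      have hy := hmem y
      rw [← h1] at hy
      simp only [h1, true_and, not_true_eq_false, false_and, or_false]
      rw [← h1]
      omega
    · simp only [h1, false_and]

/-! ### Incomparability of the ages -/

/-- Ages distinguish words up to factors and their reversals: a path together with a vertex of
another summand reveals the word written on the path. -/
theorem exists_common_factor_of_graphAge_subset {u v : ℕ → Bool}
    (hu : ∀ n, u n = true ∨ u (n + 1) = true) (hv : ∀ n, v n = true ∨ v (n + 1) = true)
    {I : ℕ → Set ℕ} (hI : IsIntervalFamily I)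
    (hsub : graphAge (wordPathSum and u I) ⊆ graphAge (wordPathSum and v I))
    {n : ℕ} (hn : 8 ≤ n) :
    ∃ a b, (∀ k < n, u (a + k) = v (b + k)) ∨ ∀ k < n, u (a + k) = v (b + (n - 1 - k)) := by
  obtain ⟨c, -, a, ha⟩ := hI.exists_gt_forall_mem 0 n
  obtain ⟨d, hd, a', ha'⟩ := hI.exists_gt_forall_mem c 2
  obtain ⟨z, hz, huz⟩ : ∃ z ∈ I d, u z = true := by
    rcases hu a' with h | h
    · exact ⟨a', ha' 0 (by omega), h⟩
    · exact ⟨a' + 1, ha' 1 (by omega), h⟩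
  let f : Fin (n + 1) → {x : ℕ × ℕ | x.2 ∈ I x.1} := fun i =>
    if h : (i : ℕ) < n then ⟨(c, a + i), ha i h⟩ else ⟨(d, z), hz⟩
  have hf : ∀ i (h : i < n), (f ⟨i, by omega⟩).1 = (c, a + i) := fun i h => by simp [f, h]
  have hfn : (f ⟨n, by omega⟩).1 = (d, z) := by simp [f]
  have hfinj : Function.Injective f := by
    intro i j hij
    have hi := i.2
    have hj := j.2
    have hij' := Subtype.ext_iff.1 hij
    by_cases h1 : (i : ℕ) < n <;> by_cases h2 : (j : ℕ) < n
    · rw [hf i h1, hf j h2] at hij'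
      ext
      simpa using hij'
    · simp only [f, h1, h2, dite_true, dite_false, Prod.mk.injEq] at hij'
      omega
    · simp only [f, h1, h2, dite_true, dite_false, Prod.mk.injEq] at hij'
      omega
    · ext
      omega
  obtain ⟨e⟩ : (wordPathSum and u I).comap f ⊴ wordPathSum and v I :=
    hsub (a := ⟨n + 1, (wordPathSum and u I).comap f⟩)
      ⟨SimpleGraph.Embedding.comap ⟨f, hfinj⟩ _⟩
  have hadj : ∀ i j, (wordGraph and v).Adj (e i).1 (e j).1 ↔
      (wordGraph and u).Adj (f i).1 (f j).1 := fun i j => e.map_adj_iff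
  let g : ℕ → ℕ × ℕ := fun i => if h : i < n then (e ⟨i, by omega⟩).1 else (0, 0)
  have hgi : ∀ i (h : i < n), g i = (e ⟨i, by omega⟩).1 := fun i h => by simp [g, h]
  have hg : IsInducedPath (wordGraph and v) g n := by
    constructor
    · intro i hi j hj
      rw [hgi i hi, hgi j hj, hadj, hf i hi, hf j hj]
      exact (isInducedPath_block u c a n).adj_iff i hi j hj
    · intro i hi j hj hij
      rw [hgi i hi, hgi j hj] at hij
      simpa using e.injective (Subtype.ext hij)
  -- The extra vertex `(d, z)` is labelled 1, so its adjacencies to the path spell the factor of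
  -- `u`.
  have happex : ∀ i < n, ((wordGraph and v).Adj (g i) (e ⟨n, by omega⟩).1 ↔
      u (a + i) = true) := by
    intro i hi
    rw [hgi i hi, hadj, hf i hi, hfn, wordGraph_and_adj]
    simp [hd.ne, huz]
  obtain ⟨c', b, hb⟩ := hg.exists_eq_block hv hn
  obtain ⟨y, hy⟩ : ∃ y, y = (e ⟨n, by omega⟩).1 := ⟨_, rfl⟩
  rw [← hy] at happex
  have hone : ∀ i, i + 1 < n → (wordGraph and v).Adj (g i) y ∨
      (wordGraph and v).Adj (g (i + 1)) y := fun i hi => by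
    rw [happex i (by omega), happex (i + 1) hi]
    exact hu (a + i)
  -- Within its own summand a vertex has at most two neighbours, but `y` has one in each of three
  -- disjoint pairs.
  have hyc : c' ≠ y.1 := by
    intro hc
    have h0 := hone 0 (by omega)
    have h2 := hone 2 (by omega)
    have h4 := hone 4 (by omega)
    simp only [wordGraph_and_adj] at h0 h2 h4
    rcases hb with hb | hb
    · rw [hb 0 (by omega), hb 1 (by omega)] at h0
      rw [hb 2 (by omega), hb 3 (by omega)] at h2
      rw [hb 4 (by omega), hb 5 (by omega)] at h4
      simp only [hc, true_and, ne_eq, not_true_eq_false, false_and, or_false] at h0 h2 h4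
      omega
    · rw [hb 0 (by omega), hb 1 (by omega)] at h0
      rw [hb 2 (by omega), hb 3 (by omega)] at h2
      rw [hb 4 (by omega), hb 5 (by omega)] at h4
      simp only [hc, true_and, ne_eq, not_true_eq_false, false_and, or_false] at h0 h2 h4
      omega
  have hgc : ∀ i < n, (g i).1 = c' := by
    rcases hb with hb | hb
    · exact fun i hi => by rw [hb i hi]
    · exact fun i hi => by rw [hb i hi]
  have hedge : ∀ i < n, ((wordGraph and v).Adj (g i) y ↔ v (g i).2 = true ∧ v y.2 = true) := by
    intro i hi
    simp [wordGraph_and_adj, hgc i hi, hyc]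
  have hvy : v y.2 = true := by
    rcases hone 0 (by omega) with h | h
    · exact ((hedge _ (by omega)).1 h).2
    · exact ((hedge _ (by omega)).1 h).2
  have hword : ∀ i < n, u (a + i) = v (g i).2 := by
    intro i hi
    rw [Bool.eq_iff_iff, ← happex i hi, hedge i hi, and_iff_left hvy]
  refine ⟨a, b, hb.imp (fun h i hi => ?_) fun h i hi => ?_⟩
  · rw [hword i hi, h i hi]
  · rw [hword i hi, h i hi]

theorem not_graphAge_subset_of_slope_ne {α β : ℝ} (hα : α ∈ Set.Ioo (1 / 2 : ℝ) 1)
    (hβ : β ∈ Set.Ioo (1 / 2 : ℝ) 1) (hne : α ≠ β) {I : ℕ → Set ℕ} (hI : IsIntervalFamily I) :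
    ¬ graphAge (wordPathSum and (mechanicalWord α) I) ⊆
      graphAge (wordPathSum and (mechanicalWord β) I) := by
  intro hsub
  obtain ⟨N, hN⟩ := exists_nat_ge (2 / |α - β|)
  rw [div_le_iff₀ (abs_pos.2 (sub_ne_zero.2 hne))] at hN
  -- `N` contradicts the closeness of the slopes; the added 8 lets the path be recognised as a
  -- block.
  obtain ⟨a, b, h⟩ := exists_common_factor_of_graphAge_subset
    (mechanicalWord_or_succ hα.1.le hα.2.le) (mechanicalWord_or_succ hβ.1.le hβ.2.le) hI hsub
    (n := N + 8) (by omega)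
  have := slope_close_of_common_factor (by linarith [hα.1]) hα.2.le (by linarith [hβ.1]) hβ.2.le h
  push_cast at this
  linarith [abs_nonneg (α - β)]

theorem injOn_mechanicalWord : Set.InjOn mechanicalWord (Set.Ioo (1 / 2 : ℝ) 1) := by
  intro α hα β hβ h
  by_contra hne
  obtain ⟨N, hN⟩ := exists_nat_ge (2 / |α - β|)
  rw [div_le_iff₀ (abs_pos.2 (sub_ne_zero.2 hne))] at hN
  have := slope_close_of_common_factor (n := N) (a := 0) (b := 0) (by linarith [hα.1]) hα.2.le
    (by linarith [hβ.1]) hβ.2.le (.inl fun k _ => by rw [h])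
  linarith

theorem theorem1 :
    ∃ (star : Bool → Bool → Bool) (U : Set (ℕ → Bool)),
      Cardinal.mk U = Cardinal.continuum ∧
      (∀ u ∈ U, UniformlyRecurrent u) ∧
      ∀ I : ℕ → Set ℕ, IsIntervalFamily I →
        (∀ u ∈ U, PathMinimal (wordPathSum star u I) ∧
          (graphAge (wordPathSum star u I)).PartiallyWellOrderedOn FinGraph.Embeds) ∧
        (∀ u ∈ U, ∀ v ∈ U, u ≠ v →
          ¬ graphAge (wordPathSum star u I) ⊆ graphAge (wordPathSum star v I) ∧
          ¬ graphAge (wordPathSum star v I) ⊆ graphAge (wordPathSum star u I)) := by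
  refine ⟨and, mechanicalWord '' Set.Ioo (1 / 2) 1, ?_, ?_, fun I hI => ⟨?_, ?_⟩⟩
  · rw [Cardinal.mk_image_eq_of_injOn _ _ injOn_mechanicalWord, Cardinal.mk_Ioo_real (by norm_num)]
  · rintro _ ⟨α, -, rfl⟩
    exact uniformlyRecurrent_mechanicalWord α
  · rintro _ ⟨α, hα, rfl⟩
    have hrec := uniformlyRecurrent_mechanicalWord α
    exact ⟨pathMinimal_wordPathSum hrec (mechanicalWord_or_succ hα.1.le hα.2.le) hI,
      partiallyWellOrderedOn_graphAge hrec I⟩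
  · rintro _ ⟨α, hα, rfl⟩ _ ⟨β, hβ, rfl⟩ hne
    have hne' : α ≠ β := fun h => hne (congrArg _ h)
    exact ⟨not_graphAge_subset_of_slope_ne hα hβ hne' hI,
      not_graphAge_subset_of_slope_ne hβ hα hne'.symm hI⟩
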